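/- Let $\mathbb D$ be the open unit disc, $\mathbb T$ the unit circle with normalised arc length, and $H^2\subset L^2(\mathbb T)$ the Hardy space. An inner function is a $\theta\in H^2$ with $|\theta|=1$ a.e. on $\mathbb T$; its model space is $K_\theta=H^2\ominus\theta H^2$, with orthogonal projection $P_\theta:L^2(\mathbb T)\to K_\theta$ and conjugation $C_\theta f=\theta\,\overline{zf}$. A truncated Toeplitz operator (TTO) on $K_\theta$ is a bounded operator $A$ on $K_\theta$ for which there is $\varphi\in L^2(\mathbb T)$ with $Af=P_\theta(\varphi f)$ for all $f\in K_\theta\cap L^\infty$. For $t\in\mathbb D$ let $k_t(z)=\frac{1-\overline{\theta(t)}\theta(z)}{1-\bar t z}$ be the reproducing kernel of $K_\theta$ at $t$, and $\kappa_t=k_t/\|k_t\|$. For $t\in\mathbb D$ and $\alpha\in\mathbb T$ the generalised Clark operator on $K_\theta$ is $$U_{t,\alpha}f=P_\theta\Big(\frac{z-t}{1-\bar t z}f\Big)+(\alpha+\theta(t))\,\langle f,C_\theta\kappa_t\rangle\,\kappa_t .$$ When $K_\theta$ is finite-dimensional, a modified Clark basis of $K_\theta$ is an orthonormal basis $(v_i)$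 of $K_\theta$ such that $C_\theta v_i=v_i$ for all $i$ and, for some $t\in\mathbb D$ and $\alpha\in\mathbb T$, every $v_i$ is an eigenvector of $U_{t,\alpha}$. Let $a,b,c\in\mathbb R$ and let $S$ be any one of the matrices $$\begin{pmatrix} a&0&1\\0&b&0\\1&0&c\end{pmatrix},\qquad \begin{pmatrix} a&1&0\\1&b&0\\0&0&c\end{pmatrix},\qquad \begin{pmatrix} a&0&0\\0&b&1\\0&1&c\end{pmatrix}.$$ Then $S$ is unitarily equivalent to a TTO on some model space $K_\theta$, but there are no inner function $\theta$, modified Clark basis of $K_\theta$ and TTO on $K_\theta$ such that $S$ is the matrix of that TTO with respect to that basis. Consequently the following question has a negative answer: is every complex symmetric matrix $M$ (i.e. $M\in\mathbb C^{n\times n}$ with $M=M^{T}$) that is unitarily equivalent to a TTO the matrix of some TTO, on some model space $K_\theta$, with respect to some modified Clark basis of $K_\theta$? -/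

import Mathlib

open MeasureTheory Complex
open scoped ENNReal InnerProductSpace ComplexConjugate UnitDisc

noncomputable section

namespace ModelSpace

/-- `L²(𝕋)`. The unit circle `𝕋` with normalised arc length is parametrised by `ℝ/ℤ` through
`x ↦ exp (2πix)`, so that the coordinate function `z` on `𝕋` is `fourier 1`, and `fourierCoeff f n`
is the coefficient of `zⁿ` in `f`. -/
abbrev L2 : Type := Lp ℂ 2 (AddCircle.haarAddCircle : Measure UnitAddCircle)

/-- The Hardy space `H²`, as a subspace of `L²(𝕋)`: the negative Fourier coefficients vanish. -/
def H2 : Submodule ℂ L2 where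
  carrier := {f | ∀ n : ℤ, n < 0 → fourierCoeff f n = 0}
  zero_mem' n _ := by
    rw [← fourierBasis_repr]; simp
  add_mem' {f g} hf hg n hn := by
    have h1 := hf n hn
    have h2 := hg n hn
    rw [← fourierBasis_repr] at h1 h2 ⊢
    simp [h1, h2]
  smul_mem' c f hf n hn := by
    have h1 := hf n hn
    rw [← fourierBasis_repr] at h1 ⊢
    simp [h1]

theorem isClosed_H2 : IsClosed (H2 : Set L2) := by
  have h : (H2 : Set L2) = ⋂ n : ℤ, ⋂ _ : n < 0, {f : L2 | ⟪fourierBasis n, f⟫_ℂ = 0} := by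
    ext f
    simp only [Set.mem_iInter, Set.mem_ofPred_eq, ← HilbertBasis.repr_apply_apply,
      fourierBasis_repr]
    rfl
  rw [h]
  exact isClosed_iInter fun n => isClosed_iInter fun _ =>
    isClosed_eq (continuous_const.inner continuous_id) continuous_const

/-- The value at a point `t` of the open unit disc of (the analytic extension of) `f ∈ H²`. -/
def diskEval (f : L2) (t : 𝔻) : ℂ := ∑' n : ℕ, fourierCoeff f (n : ℤ) * (t : ℂ) ^ n

/-- Multiplication by an essentially bounded function, on `L²(𝕋)`. -/
def mulOp (g : UnitAddCircle → ℂ) (hg : MemLp g ∞ AddCircle.haarAddCircle) : L2 →ₗ[ℂ] L2 where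
  toFun f := ((Lp.memLp f).mul (p := ∞) hg : MemLp (g * ⇑f) 2 AddCircle.haarAddCircle).toLp
  map_add' f₁ f₂ := by
    rw [← MemLp.toLp_add]
    apply MemLp.toLp_congr
    filter_upwards [Lp.coeFn_add f₁ f₂] with x hx
    rw [Pi.mul_apply, hx]
    simp [mul_add]
  map_smul' c f := by
    rw [RingHom.id_apply, ← MemLp.toLp_const_smul]
    apply MemLp.toLp_congr
    filter_upwards [Lp.coeFn_smul c f] with x hx
    rw [Pi.mul_apply, hx]
    simp [mul_left_comm]

theorem memLp_continuous (g : C(UnitAddCircle, ℂ)) : MemLp g ∞ AddCircle.haarAddCircle :=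
  memLp_top_of_bound g.continuous.aestronglyMeasurable ‖g‖
    (Filter.Eventually.of_forall g.norm_coe_le_norm)

/-- Multiplication by a continuous function, on `L²(𝕋)`. -/
def mulC (g : C(UnitAddCircle, ℂ)) : L2 →ₗ[ℂ] L2 := mulOp g (memLp_continuous g)

/-- Inner functions, through their boundary values: elements of `H²` that are unimodular
almost everywhere on `𝕋`. -/
structure InnerFunction where
  toL2 : L2
  mem_H2 : toL2 ∈ H2
  norm_eq_one : ∀ᵐ x ∂(AddCircle.haarAddCircle : Measure UnitAddCircle), ‖toL2 x‖ = 1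

theorem InnerFunction.memLp_top (θ : InnerFunction) :
    MemLp θ.toL2 ∞ AddCircle.haarAddCircle :=
  memLp_top_of_bound (Lp.aestronglyMeasurable _) 1 (θ.norm_eq_one.mono fun _ h => h.le)

/-- The model space `K_θ = H² ⊖ θH²`. -/
def K (θ : InnerFunction) : Submodule ℂ L2 :=
  H2 ⊓ (H2.map (mulOp θ.toL2 θ.memLp_top))ᗮ

instance (θ : InnerFunction) : CompleteSpace (K θ) :=
  (isClosed_H2.inter (Submodule.isClosed_orthogonal _)).completeSpace_coe

/-- The bounded operator `A` on `K_θ` is a truncated Toeplitz operator: for some symbol `φ ∈ L²`,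
`A f = P_θ (φ f)` for all bounded `f ∈ K_θ`, with `P_θ` the orthogonal projection of `L²(𝕋)`
onto `K_θ`. -/
def IsTTO (θ : InnerFunction) (A : K θ →L[ℂ] K θ) : Prop :=
  ∃ φ : L2, ∀ (f : K θ) (hf : MemLp (f : L2) ∞ AddCircle.haarAddCircle),
    A f = (K θ).orthogonalProjectionOnto (mulOp (f : L2) hf φ)

/-- The canonical conjugation `C_θ f = θ · conj (z f)`. -/
def conjC (θ : InnerFunction) (f : L2) : L2 :=
  mulOp θ.toL2 θ.memLp_top (star (mulC (fourier 1) f))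

theorem one_sub_ne_zero (t : 𝔻) (x : UnitAddCircle) : 1 - conj (t : ℂ) * fourier 1 x ≠ 0 := by
  intro h
  have h1 : ‖conj (t : ℂ) * fourier 1 x‖ = 1 := by rw [← sub_eq_zero.mp h]; simp
  rw [norm_mul, fourier_apply, Circle.norm_coe, mul_one, RCLike.norm_conj] at h1
  exact t.norm_lt_one.ne h1

/-- The function `1 / (1 - conj t · z)` on the circle. -/
def szego (t : 𝔻) : C(UnitAddCircle, ℂ) where
  toFun x := 1 / (1 - conj (t : ℂ) * fourier 1 x)
  continuous_toFun := by
    refine continuous_const.div ?_ (one_sub_ne_zero t)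
    fun_prop

/-- The function `(z - t) / (1 - conj t · z)` on the circle. -/
def moebius (t : 𝔻) : C(UnitAddCircle, ℂ) where
  toFun x := (fourier 1 x - (t : ℂ)) / (1 - conj (t : ℂ) * fourier 1 x)
  continuous_toFun := by
    refine Continuous.div ?_ ?_ (one_sub_ne_zero t) <;> fun_prop

/-- The reproducing kernel `k_t = (1 - conj (θ t) · θ) / (1 - conj t · z)` of `K_θ` at `t ∈ 𝔻`
(`fourierLp 2 0` is the constant function `1`). -/
def kernel (θ : InnerFunction) (t : 𝔻) : L2 :=
  mulC (szego t) (fourierLp 2 0 - conj (diskEval θ.toL2 t) • θ.toL2)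

/-- The normalised reproducing kernel `k_t / ‖k_t‖`. -/
def normKernel (θ : InnerFunction) (t : 𝔻) : L2 :=
  ((‖kernel θ t‖⁻¹ : ℝ) : ℂ) • kernel θ t

/-- The generalised Clark operator on `K_θ`,
`U_{t,α} f = P_θ ((z - t) / (1 - conj t · z) · f) + (α + θ t) ⟨f, C_θ κ_t⟩ κ_t`,
where `κ_t = k_t / ‖k_t‖` is the normalised kernel. Its values lie in `K_θ`; they are recorded as
elements of `L²(𝕋)`. -/
def clarkOp (θ : InnerFunction) (t : 𝔻) (α : Circle) : K θ →ₗ[ℂ] L2 :=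
  (K θ).subtype ∘ₗ (K θ).orthogonalProjectionOnto.toLinearMap ∘ₗ mulC (moebius t) ∘ₗ (K θ).subtype
    + ((α : ℂ) + diskEval θ.toL2 t) •
      ((innerSL ℂ (conjC θ (normKernel θ t))).toLinearMap.smulRight (normKernel θ t)) ∘ₗ
        (K θ).subtype

/-- An orthonormal basis of `K_θ` is a modified Clark basis if it is fixed by the conjugation `C_θ`
and consists of eigenvectors of one generalised Clark operator `U_{t,α}`. -/
def IsModifiedClarkBasis (θ : InnerFunction) {n : ℕ} (v : OrthonormalBasis (Fin n) ℂ (K θ)) :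
    Prop :=
  (∀ i, conjC θ (v i) = (v i : L2)) ∧
    ∃ (t : 𝔻) (α : Circle), ∀ i, ∃ μ : ℂ, clarkOp θ t α (v i) = μ • (v i : L2)

/-- The matrix `M`, as an operator on `ℂⁿ`, is unitarily equivalent to a truncated Toeplitz operator
on some model space. -/
def UnitarilyEquivToTTO {n : ℕ} (M : Matrix (Fin n) (Fin n) ℂ) : Prop :=
  ∃ (θ : InnerFunction) (A : K θ →L[ℂ] K θ), IsTTO θ A ∧
    ∃ U : EuclideanSpace ℂ (Fin n) ≃ₗᵢ[ℂ] K θ, ∀ x, U (M.toEuclideanLin x) = A (U x)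

/-- `M` is the matrix of a truncated Toeplitz operator on some model space with respect to some
modified Clark basis of that space. -/
def IsClarkMatrixOfTTO {n : ℕ} (M : Matrix (Fin n) (Fin n) ℂ) : Prop :=
  ∃ (θ : InnerFunction) (A : K θ →L[ℂ] K θ) (v : OrthonormalBasis (Fin n) ℂ (K θ)),
    IsTTO θ A ∧ IsModifiedClarkBasis θ v ∧
      LinearMap.toMatrix v.toBasis v.toBasis A.toLinearMap = M

end ModelSpace

end

/-!
On `K_θ` the generalised Clark operator `U_{t,α}` is multiplication by the Möbius function
`b = (z - t) / (1 - conj t · z)` minus an operator of rank one with range spanned by some `G`. Hence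
an eigenvector `v i` with eigenvalue `μ i` has the form `a i * G / (b - μ i)` with `a i ≠ 0`, and
the eigenvalues of linearly independent eigenvectors are distinct. A partial fraction identity then
makes the products `v j * v k`, `v i * v k`, `v i * v j` linearly dependent with nonzero
coefficients.

If the `v i` are fixed by `C_θ` and `A` is the truncated Toeplitz operator with symbol `φ`, then
`⟪v i, A (v j)⟫ = ⟪C_θ φ, v i * v j⟫` depends on the product only, so the entries `(j, k)`,
`(i, k)`, `(i, j)` of the matrix of `A` satisfy a linear relation with nonzero coefficients: exactly
two of them cannot vanish. On the other hand, every Hermitian matrix is unitarily equivalent to a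
circulant matrix, and all Toeplitz matrices are truncated Toeplitz operators on the model space of
`zⁿ`.
-/

noncomputable section

namespace ModelSpace

section Multiplication

variable {f : L2}

theorem coeFn_mulOp (g : UnitAddCircle → ℂ) (hg : MemLp g ∞ AddCircle.haarAddCircle) (f : L2) :
    ⇑(mulOp g hg f) =ᵐ[AddCircle.haarAddCircle] fun x => g x * f x :=
  MemLp.coeFn_toLp ((Lp.memLp f).mul (p := ∞) hg)

theorem coeFn_mulC (g : C(UnitAddCircle, ℂ)) (f : L2) :
    ⇑(mulC g f) =ᵐ[AddCircle.haarAddCircle] fun x => g x * f x :=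
  coeFn_mulOp _ _ f

theorem mulOp_mulC_comm (g : UnitAddCircle → ℂ) (hg : MemLp g ∞ AddCircle.haarAddCircle)
    (h : C(UnitAddCircle, ℂ)) (f : L2) : mulOp g hg (mulC h f) = mulC h (mulOp g hg f) := by
  apply Lp.ext
  filter_upwards [coeFn_mulOp g hg (mulC h f), coeFn_mulC h f, coeFn_mulC h (mulOp g hg f),
    coeFn_mulOp g hg f] with x h1 h2 h3 h4
  rw [h1, h2, h3, h4, mul_left_comm]

theorem mulOp_fourierLp (hf : MemLp f ∞ AddCircle.haarAddCircle) (n : ℤ) :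
    mulOp f hf (fourierLp 2 n) = mulC (fourier n) f := by
  apply Lp.ext
  filter_upwards [coeFn_mulOp f hf (fourierLp 2 n), coeFn_mulC (fourier n) f,
    coeFn_fourierLp (T := 1) 2 n] with x h1 h2 h3
  rw [h1, h2, h3, mul_comm]

theorem mulC_fourier_fourierLp (m n : ℤ) :
    mulC (fourier m) (fourierLp 2 n) = fourierLp 2 (m + n) := by
  apply Lp.ext
  filter_upwards [coeFn_mulC (fourier m) (fourierLp 2 n), coeFn_fourierLp (T := 1) 2 n,
    coeFn_fourierLp (T := 1) 2 (m + n)] with x h1 h2 h3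
  rw [h1, h2, h3, fourier_add]

/-- The bounded functions, as a subspace of `L²(𝕋)`. -/
def boundedFunctions : Submodule ℂ L2 where
  carrier := {f | MemLp f ∞ AddCircle.haarAddCircle}
  zero_mem' := (memLp_congr_ae (Lp.coeFn_zero _ _ _)).mpr MemLp.zero
  add_mem' hf hg := (memLp_congr_ae (Lp.coeFn_add _ _)).mpr (hf.add hg)
  smul_mem' c _ hf := (memLp_congr_ae (Lp.coeFn_smul _ _)).mpr (hf.const_smul c)

theorem mulOp_mem_boundedFunctions {g : UnitAddCircle → ℂ}
    (hg : MemLp g ∞ AddCircle.haarAddCircle) (hf : f ∈ boundedFunctions) :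
    mulOp g hg f ∈ boundedFunctions :=
  (memLp_congr_ae (coeFn_mulOp g hg f)).mpr (hf.mul (p := ∞) hg)

theorem fourierLp_mem_boundedFunctions (n : ℤ) : fourierLp 2 n ∈ boundedFunctions :=
  (memLp_congr_ae (coeFn_fourierLp 2 n)).mpr (memLp_continuous _)

end Multiplication

section FourierCoefficients

variable {f : L2}

theorem inner_fourierLp (n : ℤ) (f : L2) : ⟪(fourierLp 2 n : L2), f⟫_ℂ = fourierCoeff f n := by
  rw [← fourierBasis_repr, HilbertBasis.repr_apply_apply, coe_fourierBasis]

theorem fourierCoeff_fourierLp (m n : ℤ) :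
    fourierCoeff (fourierLp 2 m : L2) n = if n = m then 1 else 0 := by
  rw [← inner_fourierLp]
  exact orthonormal_iff_ite.mp (orthonormal_fourier (T := (1 : ℝ))) n m

theorem eq_zero_of_fourierCoeff_eq_zero (h : ∀ n, fourierCoeff f n = 0) : f = 0 := by
  apply (fourierBasis (T := (1 : ℝ))).repr.injective
  ext n
  rw [fourierBasis_repr, h n, map_zero, lp.coeFn_zero, Pi.zero_apply]

theorem norm_fourierCoeff_le (f : L2) (n : ℤ) : ‖fourierCoeff f n‖ ≤ ‖f‖ := by
  have hunit : ‖(fourierLp 2 n : L2)‖ = 1 := (orthonormal_fourier (T := (1 : ℝ))).1 n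
  simpa only [inner_fourierLp, hunit, one_mul] using
    norm_inner_le_norm (𝕜 := ℂ) (fourierLp 2 n : L2) f

theorem fourierCoeff_mulC_fourier (m n : ℤ) (f : L2) :
    fourierCoeff (mulC (fourier m) f) n = fourierCoeff f (n - m) := by
  rw [fourierCoeff_congr_ae (coeFn_mulC (fourier m) f)]
  refine integral_congr_ae (.of_forall fun x => ?_)
  simp only [smul_eq_mul]
  rw [← mul_assoc, ← fourier_add, neg_sub, sub_eq_neg_add, add_comm]

theorem fourierLp_mem_H2 {n : ℤ} (hn : 0 ≤ n) : fourierLp 2 n ∈ H2 := fun m hm => by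
  rw [fourierCoeff_fourierLp, if_neg (by lia)]

theorem mem_H2_orthogonal_iff : f ∈ H2ᗮ ↔ ∀ n : ℤ, 0 ≤ n → fourierCoeff f n = 0 := by
  refine ⟨fun hf n hn => ?_, fun hf => (Submodule.mem_orthogonal _ _).mpr fun g hg => ?_⟩
  · rw [← inner_fourierLp]
    exact Submodule.inner_right_of_mem_orthogonal (fourierLp_mem_H2 hn) hf
  · rw [← (fourierBasis (T := (1 : ℝ))).tsum_inner_mul_inner g f]
    refine (tsum_congr fun n => ?_).trans tsum_zero
    rw [← inner_conj_symm, coe_fourierBasis, inner_fourierLp, inner_fourierLp]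
    rcases lt_or_ge n 0 with hn | hn
    · rw [hg n hn, map_zero, zero_mul]
    · rw [hf n hn, mul_zero]

theorem mulC_fourier_mem_H2 {n : ℤ} (hn : 0 ≤ n) (hf : f ∈ H2) : mulC (fourier n) f ∈ H2 :=
  fun m hm => by
    rw [fourierCoeff_mulC_fourier]
    exact hf _ (by lia)

end FourierCoefficients

section CauchyKernel

variable {f u : L2} (t : 𝔻)

theorem szego_mul_cancel (x : UnitAddCircle) :
    (1 - conj (t : ℂ) * fourier 1 x) * szego t x = 1 :=
  mul_one_div_cancel (one_sub_ne_zero t x)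

theorem mulC_szego_eq (f : L2) :
    mulC (szego t) f = f + conj (t : ℂ) • mulC (fourier 1) (mulC (szego t) f) := by
  apply Lp.ext
  filter_upwards [coeFn_mulC (szego t) f, coeFn_mulC (fourier 1) (mulC (szego t) f),
    Lp.coeFn_add f (conj (t : ℂ) • mulC (fourier 1) (mulC (szego t) f)),
    Lp.coeFn_smul (conj (t : ℂ)) (mulC (fourier 1) (mulC (szego t) f))] with x h1 h2 h3 h4
  rw [h3, Pi.add_apply, h4, Pi.smul_apply, h2, h1, smul_eq_mul]
  linear_combination f x * szego_mul_cancel t x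

theorem fourierCoeff_mulC_szego (f : L2) (n : ℤ) :
    fourierCoeff (mulC (szego t) f) n =
      fourierCoeff f n + conj (t : ℂ) * fourierCoeff (mulC (szego t) f) (n - 1) := by
  conv_lhs => rw [mulC_szego_eq]
  rw [← inner_fourierLp, inner_add_right, inner_smul_right, inner_fourierLp, inner_fourierLp,
    fourierCoeff_mulC_fourier]

theorem eq_zero_of_eq_mul_succ {𝕜 : Type*} [NormedField 𝕜] {a : ℕ → 𝕜} {w : 𝕜} {C : ℝ}
    (hw : ‖w‖ < 1) (hbound : ∀ k, ‖a k‖ ≤ C) (hrec : ∀ k, a k = w * a (k + 1)) : a 0 = 0 := by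
  have hpow (k : ℕ) : a 0 = w ^ k * a k := by
    induction k with
    | zero => rw [pow_zero, one_mul]
    | succ k ih => rw [ih, hrec k, pow_succ, mul_assoc]
  have hlim : Filter.Tendsto (fun k : ℕ => ‖w‖ ^ k * C) Filter.atTop (nhds 0) := by
    simpa only [zero_mul] using
      (tendsto_pow_atTop_nhds_zero_of_lt_one (norm_nonneg w) hw).mul_const C
  refine norm_le_zero_iff.mp (ge_of_tendsto' hlim fun k => ?_)
  rw [hpow k, norm_mul, norm_pow]
  gcongr
  exact hbound k

theorem mulC_szego_mem_H2 (hf : f ∈ H2) : mulC (szego t) f ∈ H2 := fun n hn => by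
  have hzero := eq_zero_of_eq_mul_succ (a := fun k => fourierCoeff (mulC (szego t) f) (n - k))
    (w := conj (t : ℂ)) (by rw [RCLike.norm_conj]; exact t.norm_lt_one)
    (fun k => norm_fourierCoeff_le _ _) fun k => by
      rw [fourierCoeff_mulC_szego, hf _ (by lia), zero_add, Nat.cast_succ, sub_sub]
  simpa only [Nat.cast_zero, sub_zero] using hzero

theorem mulC_fourier_one_sub_mem_H2_orthogonal (hu : u ∈ H2ᗮ) :
    mulC (fourier 1) u - fourierCoeff u (-1) • fourierLp 2 0 ∈ H2ᗮ := by
  rw [mem_H2_orthogonal_iff] at hu ⊢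
  intro n hn
  rw [← inner_fourierLp, inner_sub_right, inner_smul_right, inner_fourierLp, inner_fourierLp,
    fourierCoeff_mulC_fourier, fourierCoeff_fourierLp]
  rcases hn.eq_or_lt with rfl | hn
  · rw [if_pos rfl, zero_sub, mul_one, sub_self]
  · rw [if_neg hn.ne', hu (n - 1) (by lia), mul_zero, sub_zero]

theorem mulC_fourier_one_mulC_szego_sub_mem_H2_orthogonal (hu : u ∈ H2ᗮ) :
    mulC (fourier 1) (mulC (szego t) u) -
      fourierCoeff (mulC (szego t) u) (-1) • mulC (szego t) (fourierLp 2 0) ∈ H2ᗮ := by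
  rw [mem_H2_orthogonal_iff] at hu ⊢
  intro n hn
  rw [← inner_fourierLp, inner_sub_right, inner_smul_right, inner_fourierLp, inner_fourierLp,
    fourierCoeff_mulC_fourier, sub_eq_zero]
  lift n to ℕ using hn
  induction n with
  | zero =>
    have hneg : fourierCoeff (mulC (szego t) (fourierLp 2 0)) (-1) = 0 :=
      mulC_szego_mem_H2 t (fourierLp_mem_H2 le_rfl) (-1) (by lia)
    rw [Nat.cast_zero, zero_sub, fourierCoeff_mulC_szego t (fourierLp 2 0), fourierCoeff_fourierLp,
      if_pos rfl, zero_sub, hneg, mul_zero, add_zero, mul_one]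
  | succ n ih =>
    have hn : (n : ℤ) + 1 ≠ 0 := by lia
    rw [Nat.cast_succ, add_sub_cancel_right, fourierCoeff_mulC_szego t u, hu n (Nat.cast_nonneg n),
      ih, fourierCoeff_mulC_szego t (fourierLp 2 0) (n + 1), fourierCoeff_fourierLp, if_neg hn,
      add_sub_cancel_right, zero_add, zero_add, mul_left_comm]

end CauchyKernel

section ModelSpace

variable (θ : InnerFunction) {f g : L2}

theorem conj_toL2_mul_toL2 :
    ∀ᵐ x ∂(AddCircle.haarAddCircle : Measure UnitAddCircle), conj (θ.toL2 x) * θ.toL2 x = 1 := by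
  filter_upwards [θ.norm_eq_one] with x hx
  rw [Complex.conj_mul', hx, ofReal_one, one_pow]

/-- Multiplication by the complex conjugate of the inner function `θ`, on `L²(𝕋)`. It is both the
inverse and the adjoint of multiplication by `θ`. -/
def mulConj : L2 →ₗ[ℂ] L2 :=
  mulOp (fun x => conj (θ.toL2 x)) θ.memLp_top.star

theorem coeFn_mulConj (f : L2) :
    ⇑(mulConj θ f) =ᵐ[AddCircle.haarAddCircle] fun x => conj (θ.toL2 x) * f x :=
  coeFn_mulOp _ _ f

theorem mulConj_mulOp_toL2 (f : L2) : mulConj θ (mulOp θ.toL2 θ.memLp_top f) = f := by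
  apply Lp.ext
  filter_upwards [coeFn_mulConj θ (mulOp θ.toL2 θ.memLp_top f), coeFn_mulOp _ θ.memLp_top f,
    conj_toL2_mul_toL2 θ] with x h1 h2 hθ
  rw [h1, h2, ← mul_assoc, hθ, one_mul]

theorem inner_mulOp_toL2_left (g f : L2) :
    ⟪mulOp θ.toL2 θ.memLp_top g, f⟫_ℂ = ⟪g, mulConj θ f⟫_ℂ := by
  rw [L2.inner_def, L2.inner_def]
  apply integral_congr_ae
  filter_upwards [coeFn_mulOp _ θ.memLp_top g, coeFn_mulConj θ f] with x h1 h2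
  rw [h1, h2]
  simp only [RCLike.inner_apply, map_mul]
  ring

theorem mulOp_toL2_fourierLp_zero : mulOp θ.toL2 θ.memLp_top (fourierLp 2 0) = θ.toL2 := by
  apply Lp.ext
  filter_upwards [coeFn_mulOp _ θ.memLp_top (fourierLp 2 0), coeFn_fourierLp (T := 1) 2 0]
    with x h1 h2
  rw [h1, h2, fourier_zero, mul_one]

variable {θ}

theorem mem_K_iff : f ∈ K θ ↔ f ∈ H2 ∧ mulConj θ f ∈ H2ᗮ := by
  simp only [K, Submodule.mem_inf, Submodule.mem_orthogonal, Submodule.mem_map,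
    forall_exists_index, and_imp, forall_apply_eq_imp_iff₂, inner_mulOp_toL2_left]

theorem mulOp_toL2_mem_K_orthogonal (hg : g ∈ H2) :
    mulOp θ.toL2 θ.memLp_top g ∈ (K θ)ᗮ :=
  (Submodule.mem_orthogonal' _ _).mpr fun f hf => by
    rw [inner_mulOp_toL2_left]
    exact Submodule.inner_right_of_mem_orthogonal hg (mem_K_iff.mp hf).2

variable (θ) in
theorem mulConj_fourierLp_mem_H2_orthogonal {n : ℤ} (hn : n < 0) :
    mulConj θ (fourierLp 2 n) ∈ H2ᗮ := by
  refine mem_H2_orthogonal_iff.mpr fun m hm => ?_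
  rw [← inner_fourierLp, ← inner_mulOp_toL2_left, mulOp_fourierLp, ← inner_conj_symm,
    inner_fourierLp, mulC_fourier_mem_H2 hm θ.mem_H2 n hn, map_zero]

theorem mulOp_toL2_mem_H2 (hg : g ∈ H2) : mulOp θ.toL2 θ.memLp_top g ∈ H2 := fun n hn => by
  rw [← inner_fourierLp, ← inner_conj_symm, inner_mulOp_toL2_left,
    Submodule.inner_right_of_mem_orthogonal hg (mulConj_fourierLp_mem_H2_orthogonal θ hn), map_zero]

variable (θ) in
theorem exists_bounded_mem_H2_mulConj_fourierLp_sub_mem (n : ℕ) :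
    ∃ q ∈ H2 ⊓ boundedFunctions, mulConj θ (fourierLp 2 (n - 1)) - q ∈ H2ᗮ := by
  -- `q` is the analytic part of `conj θ · zⁿ⁻¹`: a polynomial, hence bounded.
  induction n with
  | zero =>
    refine ⟨0, zero_mem _, ?_⟩
    rw [sub_zero]
    exact mulConj_fourierLp_mem_H2_orthogonal θ (by lia)
  | succ n ih =>
    obtain ⟨q, ⟨hq, hq_bdd⟩, hu⟩ := ih
    refine ⟨mulC (fourier 1) q +
      fourierCoeff (mulConj θ (fourierLp 2 (n - 1)) - q : L2) (-1) • fourierLp 2 0,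
      ⟨H2.add_mem (mulC_fourier_mem_H2 zero_le_one hq)
        (H2.smul_mem _ (fourierLp_mem_H2 le_rfl)),
        boundedFunctions.add_mem (mulOp_mem_boundedFunctions _ hq_bdd)
          (boundedFunctions.smul_mem _ (fourierLp_mem_boundedFunctions 0))⟩, ?_⟩
    have hz : (((n + 1 : ℕ) : ℤ) - 1) = 1 + (n - 1) := by lia
    rw [hz, ← mulC_fourier_fourierLp, mulConj, mulOp_mulC_comm, ← mulConj, ← sub_sub, ← map_sub]
    exact mulC_fourier_one_sub_mem_H2_orthogonal hu

variable (θ) in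
theorem exists_bounded_mem_K_inner_eq_fourierCoeff (n : ℕ) :
    ∃ g ∈ K θ ⊓ boundedFunctions, ∀ f ∈ K θ, ⟪g, f⟫_ℂ = fourierCoeff f n := by
  obtain ⟨q, ⟨hq, hq_bdd⟩, hu⟩ := exists_bounded_mem_H2_mulConj_fourierLp_sub_mem θ (n + 1)
  rw [Nat.cast_succ, add_sub_cancel_right] at hu
  refine ⟨fourierLp 2 n - mulOp θ.toL2 θ.memLp_top q, ⟨mem_K_iff.mpr ⟨?_, ?_⟩, ?_⟩, fun f hf => ?_⟩
  · exact H2.sub_mem (fourierLp_mem_H2 n.cast_nonneg) (mulOp_toL2_mem_H2 hq)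
  · rwa [map_sub, mulConj_mulOp_toL2]
  · exact boundedFunctions.sub_mem (fourierLp_mem_boundedFunctions n)
      (mulOp_mem_boundedFunctions _ hq_bdd)
  · rw [inner_sub_left, inner_fourierLp, Submodule.inner_left_of_mem_orthogonal hf
      (mulOp_toL2_mem_K_orthogonal hq), sub_zero]

variable (θ) in
theorem K_le_boundedFunctions [FiniteDimensional ℂ (K θ)] : K θ ≤ boundedFunctions := by
  suffices boundedFunctions.comap (K θ).subtype = ⊤ by
    rwa [Submodule.comap_subtype_eq_top] at this
  rw [← Submodule.orthogonal_eq_bot_iff, Submodule.eq_bot_iff]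
  refine fun f hf => Subtype.ext (eq_zero_of_fourierCoeff_eq_zero fun n => ?_)
  rcases lt_or_ge n 0 with hn | hn
  · exact (mem_K_iff.mp f.2).1 n hn
  · lift n to ℕ using hn
    obtain ⟨g, ⟨hgK, hg_bdd⟩, hg⟩ := exists_bounded_mem_K_inner_eq_fourierCoeff θ n
    rw [← hg f f.2]
    exact (Submodule.mem_orthogonal _ _).mp hf ⟨g, hgK⟩ hg_bdd

end ModelSpace

section ClarkOperators

variable (θ : InnerFunction) (t : 𝔻)

theorem mulC_moebius (f : L2) :
    mulC (moebius t) f =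
      (1 - conj (t : ℂ) * t) • mulC (fourier 1) (mulC (szego t) f) - (t : ℂ) • f := by
  apply Lp.ext
  filter_upwards [coeFn_mulC (moebius t) f,
    Lp.coeFn_sub ((1 - conj (t : ℂ) * t) • mulC (fourier 1) (mulC (szego t) f)) ((t : ℂ) • f),
    Lp.coeFn_smul (1 - conj (t : ℂ) * t) (mulC (fourier 1) (mulC (szego t) f)),
    Lp.coeFn_smul (t : ℂ) f, coeFn_mulC (fourier 1) (mulC (szego t) f), coeFn_mulC (szego t) f]
    with x h1 h2 h3 h4 h5 h6
  have hmoebius : moebius t x = (fourier 1 x - t) * szego t x := div_eq_mul_one_div _ _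
  rw [h1, h2, Pi.sub_apply, h3, h4, Pi.smul_apply, Pi.smul_apply, h5, h6, hmoebius, smul_eq_mul,
    smul_eq_mul]
  linear_combination (-(t : ℂ) * f x) * szego_mul_cancel t x

theorem mulC_szego_toL2 :
    mulC (szego t) θ.toL2 = mulOp θ.toL2 θ.memLp_top (mulC (szego t) (fourierLp 2 0)) := by
  rw [mulOp_mulC_comm, mulOp_toL2_fourierLp_zero]

/-- The coefficient of `z⁻¹` in `conj θ · f / (1 - conj t · z)`. On `K_θ` this is the functional
`f ↦ ⟨f, C_θ k_t⟩` entering the generalised Clark operators. -/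
def clarkFunctional (f : L2) : ℂ := fourierCoeff (mulC (szego t) (mulConj θ f)) (-1)

variable {θ} in
theorem mulC_moebius_sub_mem_K {f : L2} (hf : f ∈ K θ) :
    mulC (moebius t) f - ((1 - conj (t : ℂ) * t) * clarkFunctional θ t f) •
      mulC (szego t) θ.toL2 ∈ K θ := by
  have hmem : mulC (fourier 1) (mulC (szego t) f) -
      clarkFunctional θ t f • mulC (szego t) θ.toL2 ∈ K θ := by
    obtain ⟨hf_H2, hf_orth⟩ := mem_K_iff.mp hf
    refine mem_K_iff.mpr ⟨H2.sub_mem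
      (mulC_fourier_mem_H2 zero_le_one (mulC_szego_mem_H2 t hf_H2))
      (H2.smul_mem _ (mulC_szego_mem_H2 t θ.mem_H2)), ?_⟩
    rw [map_sub, map_smul, mulC_szego_toL2, mulConj_mulOp_toL2, mulConj, mulOp_mulC_comm,
      mulOp_mulC_comm]
    exact mulC_fourier_one_mulC_szego_sub_mem_H2_orthogonal t hf_orth
  rw [mulC_moebius, sub_right_comm, mul_smul, ← smul_sub]
  exact (K θ).sub_mem ((K θ).smul_mem _ hmem) ((K θ).smul_mem _ hf)

theorem orthogonalProjectionOnto_mulC_moebius (f : K θ) :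
    ((K θ).orthogonalProjectionOnto (mulC (moebius t) (f : L2)) : L2) =
      mulC (moebius t) (f : L2) - ((1 - conj (t : ℂ) * t) * clarkFunctional θ t f) •
        mulC (szego t) θ.toL2 := by
  refine Submodule.eq_starProjection_of_mem_orthogonal' (mulC_moebius_sub_mem_K t f.2)
    ((K θ)ᗮ.smul_mem _ ?_) (sub_add_cancel _ _).symm
  rw [mulC_szego_toL2]
  exact mulOp_toL2_mem_K_orthogonal (mulC_szego_mem_H2 t (fourierLp_mem_H2 le_rfl))

theorem coeFn_conjC (f : L2) :
    ⇑(conjC θ f) =ᵐ[AddCircle.haarAddCircle] fun x => θ.toL2 x * conj (fourier 1 x * f x) := by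
  filter_upwards [coeFn_mulOp θ.toL2 θ.memLp_top (star (mulC (fourier 1) f)),
    Lp.coeFn_star (mulC (fourier 1) f), coeFn_mulC (fourier 1) f] with x h1 h2 h3
  rw [conjC, h1, h2, Pi.star_apply, h3, RCLike.star_def]

theorem coeFn_normKernel :
    ⇑(normKernel θ t) =ᵐ[AddCircle.haarAddCircle] fun x => ((‖kernel θ t‖⁻¹ : ℝ) : ℂ) *
      (szego t x * (1 - conj (diskEval θ.toL2 t) * θ.toL2 x)) := by
  filter_upwards [Lp.coeFn_smul ((‖kernel θ t‖⁻¹ : ℝ) : ℂ) (kernel θ t),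
    coeFn_mulC (szego t) (fourierLp 2 0 - conj (diskEval θ.toL2 t) • θ.toL2),
    Lp.coeFn_sub (fourierLp 2 0 : L2) (conj (diskEval θ.toL2 t) • θ.toL2),
    Lp.coeFn_smul (conj (diskEval θ.toL2 t)) θ.toL2, coeFn_fourierLp (T := 1) 2 0]
    with x h1 h2 h3 h4 h5
  rw [normKernel, h1, Pi.smul_apply, kernel, h2, h3, Pi.sub_apply, h4, h5, Pi.smul_apply,
    fourier_zero, smul_eq_mul, smul_eq_mul]

variable {θ} in
theorem inner_conjC_normKernel {f : L2} (hf : f ∈ H2) :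
    ⟪conjC θ (normKernel θ t), f⟫_ℂ = ((‖kernel θ t‖⁻¹ : ℝ) : ℂ) * clarkFunctional θ t f := by
  have hcoeff : fourierCoeff (mulC (szego t) f) (-1) = 0 :=
    mulC_szego_mem_H2 t hf (-1) (by lia)
  calc ⟪conjC θ (normKernel θ t), f⟫_ℂ
      = ⟪(fourierLp 2 (-1) : L2), ((‖kernel θ t‖⁻¹ : ℝ) : ℂ) • (mulC (szego t) (mulConj θ f) -
          conj (diskEval θ.toL2 t) • mulC (szego t) f)⟫_ℂ := by
        rw [L2.inner_def, L2.inner_def]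
        apply integral_congr_ae
        filter_upwards [coeFn_conjC θ (normKernel θ t), coeFn_normKernel θ t,
          coeFn_fourierLp (T := 1) 2 (-1), Lp.coeFn_smul ((‖kernel θ t‖⁻¹ : ℝ) : ℂ)
            (mulC (szego t) (mulConj θ f) - conj (diskEval θ.toL2 t) • mulC (szego t) f),
          Lp.coeFn_sub (mulC (szego t) (mulConj θ f))
            (conj (diskEval θ.toL2 t) • mulC (szego t) f),
          Lp.coeFn_smul (conj (diskEval θ.toL2 t)) (mulC (szego t) f),
          coeFn_mulC (szego t) (mulConj θ f), coeFn_mulC (szego t) f, coeFn_mulConj θ f,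
          conj_toL2_mul_toL2 θ] with x h1 h2 h3 h4 h5 h6 h7 h8 h9 hθ
        rw [h1, h2, h3, h4, Pi.smul_apply, h5, Pi.sub_apply, h6, h7, Pi.smul_apply, h8, h9,
          RCLike.inner_apply, RCLike.inner_apply, fourier_neg, map_mul, Complex.conj_conj,
          Complex.conj_conj, smul_eq_mul, smul_eq_mul]
        linear_combination (-f x * fourier 1 x * ((‖kernel θ t‖⁻¹ : ℝ) : ℂ) * szego t x *
          conj (diskEval θ.toL2 t)) * hθ
    _ = ((‖kernel θ t‖⁻¹ : ℝ) : ℂ) * clarkFunctional θ t f := by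
        rw [inner_smul_right, inner_sub_right, inner_smul_right, inner_fourierLp, inner_fourierLp,
          hcoeff, mul_zero, sub_zero, clarkFunctional]

/-- The function `G` for which the generalised Clark operator `U_{t,α}` is multiplication by
`(z - t) / (1 - conj t · z)` minus the rank one operator `clarkFunctional θ t · G`. -/
def clarkFunction (α : Circle) : L2 :=
  (1 - conj (t : ℂ) * t) • mulC (szego t) θ.toL2 -
    (((α : ℂ) + diskEval θ.toL2 t) * ((‖kernel θ t‖⁻¹ : ℝ) : ℂ)) • normKernel θ t

theorem clarkOp_apply (α : Circle) (f : K θ) :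
    clarkOp θ t α f =
      mulC (moebius t) (f : L2) - clarkFunctional θ t f • clarkFunction θ t α := by
  have hclark : clarkOp θ t α f =
      ((K θ).orthogonalProjectionOnto (mulC (moebius t) (f : L2)) : L2) +
        ((α : ℂ) + diskEval θ.toL2 t) •
          ⟪conjC θ (normKernel θ t), (f : L2)⟫_ℂ • normKernel θ t := rfl
  rw [hclark, orthogonalProjectionOnto_mulC_moebius,
    inner_conjC_normKernel t (mem_K_iff.mp f.2).1, clarkFunction]
  module

theorem moebius_injective : Function.Injective (moebius t) := by
  intro x y hxy
  have hcross := (div_eq_div_iff (one_sub_ne_zero t x) (one_sub_ne_zero t y)).mp hxy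
  have ht : 1 - conj (t : ℂ) * t ≠ 0 := by
    rw [Complex.conj_mul', sub_ne_zero]
    norm_cast
    exact (pow_lt_one₀ (norm_nonneg _) t.norm_lt_one two_ne_zero).ne'
  have hz : fourier 1 x = fourier 1 y :=
    mul_left_cancel₀ ht (by linear_combination hcross)
  rw [fourier_one, fourier_one] at hz
  exact AddCircle.injective_toCircle one_ne_zero (Circle.coe_injective hz)

theorem ae_moebius_ne (μ : ℂ) :
    ∀ᵐ x ∂(AddCircle.haarAddCircle : Measure UnitAddCircle), moebius t x ≠ μ := by
  have hnontrivial : Nontrivial UnitAddCircle :=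
    ⟨((1 / 2 : ℝ) : UnitAddCircle), 0, fun h => by
      rw [AddCircle.coe_eq_zero_iff_of_mem_Ico (by norm_num)] at h
      norm_num at h⟩
  have hsub : {x | moebius t x = μ}.Subsingleton := fun x hx y hy =>
    moebius_injective t (hx.trans hy.symm)
  exact measure_eq_zero_iff_ae_notMem.mp (hsub.measure_zero _)

variable {t}

theorem eq_zero_of_mulC_moebius_eq_smul {f : L2} {μ : ℂ} (h : mulC (moebius t) f = μ • f) :
    f = 0 := by
  rw [Lp.eq_zero_iff_ae_eq_zero]
  filter_upwards [coeFn_mulC (moebius t) f, Lp.coeFn_smul μ f, ae_moebius_ne t μ] with x h1 h2 hμ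
  rw [h, h2, Pi.smul_apply, smul_eq_mul] at h1
  exact (mul_eq_mul_right_iff.mp h1).resolve_left (Ne.symm hμ)

variable {θ} {α : Circle}

theorem clarkFunctional_ne_zero {f : K θ} {μ : ℂ} (hf : f ≠ 0)
    (h : clarkOp θ t α f = μ • (f : L2)) : clarkFunctional θ t f ≠ 0 := fun h0 => by
  rw [clarkOp_apply, h0, zero_smul, sub_zero] at h
  exact hf (Subtype.ext (eq_zero_of_mulC_moebius_eq_smul h))

theorem mem_span_singleton_of_clarkOp_eq_smul {f g : K θ} {μ : ℂ} (hg : g ≠ 0)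
    (hfμ : clarkOp θ t α f = μ • (f : L2)) (hgμ : clarkOp θ t α g = μ • (g : L2)) :
    f ∈ Submodule.span ℂ {g} := by
  have hzero : clarkFunctional θ t g • f - clarkFunctional θ t f • g = 0 := by
    refine Subtype.ext (eq_zero_of_mulC_moebius_eq_smul (t := t) (μ := μ) ?_)
    rw [clarkOp_apply, sub_eq_iff_eq_add] at hfμ hgμ
    push_cast
    rw [map_sub, map_smul, map_smul, hfμ, hgμ]
    module
  refine (Submodule.smul_mem_iff _ (clarkFunctional_ne_zero hg hgμ)).mp ?_
  rw [sub_eq_zero.mp hzero]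
  exact Submodule.smul_mem _ _ (Submodule.mem_span_singleton_self g)

theorem clarkOp_eigenvalue_injective {ι : Type*} {v : ι → K θ} {μ : ι → ℂ}
    (hv : LinearIndependent ℂ v) (hμ : ∀ i, clarkOp θ t α (v i) = μ i • (v i : L2)) :
    Function.Injective μ := by
  intro i j hij
  by_contra hne
  apply hv.notMem_span_image (s := {j}) (x := i) hne
  rw [Set.image_singleton]
  exact mem_span_singleton_of_clarkOp_eq_smul (hv.ne_zero j) (hμ i) (hij ▸ hμ j)

end ClarkOperators

section OffDiagonalEntries

variable {θ : InnerFunction}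

theorem inner_conjC_mulOp (θ : InnerFunction) {f g : L2} (hf : MemLp f ∞ AddCircle.haarAddCircle)
    (hg : MemLp g ∞ AddCircle.haarAddCircle) (φ : L2) :
    ⟪conjC θ f, mulOp g hg φ⟫_ℂ = ⟪conjC θ φ, mulOp f hf g⟫_ℂ := by
  rw [L2.inner_def, L2.inner_def]
  apply integral_congr_ae
  filter_upwards [coeFn_conjC θ f, coeFn_conjC θ φ, coeFn_mulOp g hg φ, coeFn_mulOp f hf g]
    with x h1 h2 h3 h4
  rw [h1, h2, h3, h4]
  simp only [RCLike.inner_apply, map_mul, Complex.conj_conj]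
  ring

theorem linear_relation_mulOp_of_mulC_eq {q : C(UnitAddCircle, ℂ)} {f₁ f₂ f₃ G : L2}
    {μ₁ μ₂ μ₃ a₁ a₂ a₃ : ℂ} (hf₁ : MemLp f₁ ∞ AddCircle.haarAddCircle)
    (hf₂ : MemLp f₂ ∞ AddCircle.haarAddCircle)
    (hq : ∀ μ, ∀ᵐ x ∂(AddCircle.haarAddCircle : Measure UnitAddCircle), q x ≠ μ)
    (h₁ : mulC q f₁ = μ₁ • f₁ + a₁ • G) (h₂ : mulC q f₂ = μ₂ • f₂ + a₂ • G)
    (h₃ : mulC q f₃ = μ₃ • f₃ + a₃ • G) :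
    ((μ₂ - μ₃) * a₁) • mulOp f₂ hf₂ f₃ + ((μ₃ - μ₁) * a₂) • mulOp f₁ hf₁ f₃ +
      ((μ₁ - μ₂) * a₃) • mulOp f₁ hf₁ f₂ = 0 := by
  have pointwise {f : L2} {μ a : ℂ} (h : mulC q f = μ • f + a • G) :
      ∀ᵐ x ∂(AddCircle.haarAddCircle : Measure UnitAddCircle), (q x - μ) * f x = a * G x := by
    filter_upwards [coeFn_mulC q f, Lp.coeFn_add (μ • f) (a • G), Lp.coeFn_smul μ f,
      Lp.coeFn_smul a G] with x e1 e2 e3 e4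
    rw [h, e2, Pi.add_apply, e3, e4, Pi.smul_apply, Pi.smul_apply, smul_eq_mul, smul_eq_mul] at e1
    linear_combination -e1
  rw [Lp.eq_zero_iff_ae_eq_zero]
  filter_upwards [pointwise h₁, pointwise h₂, pointwise h₃, hq μ₁, hq μ₂, hq μ₃,
    Lp.coeFn_add (((μ₂ - μ₃) * a₁) • mulOp f₂ hf₂ f₃ + ((μ₃ - μ₁) * a₂) • mulOp f₁ hf₁ f₃)
      (((μ₁ - μ₂) * a₃) • mulOp f₁ hf₁ f₂),
    Lp.coeFn_add (((μ₂ - μ₃) * a₁) • mulOp f₂ hf₂ f₃) (((μ₃ - μ₁) * a₂) • mulOp f₁ hf₁ f₃),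
    Lp.coeFn_smul ((μ₂ - μ₃) * a₁) (mulOp f₂ hf₂ f₃),
    Lp.coeFn_smul ((μ₃ - μ₁) * a₂) (mulOp f₁ hf₁ f₃),
    Lp.coeFn_smul ((μ₁ - μ₂) * a₃) (mulOp f₁ hf₁ f₂),
    coeFn_mulOp f₂ hf₂ f₃, coeFn_mulOp f₁ hf₁ f₃, coeFn_mulOp f₁ hf₁ f₂]
    with x p1 p2 p3 n1 n2 n3 e1 e2 e3 e4 e5 e6 e7 e8
  rw [e1, Pi.add_apply, e2, Pi.add_apply, e3, e4, e5, Pi.smul_apply, Pi.smul_apply, Pi.smul_apply,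
    e6, e7, e8, Pi.zero_apply]
  have hprod : (q x - μ₁) * (q x - μ₂) * (q x - μ₃) ≠ 0 :=
    mul_ne_zero (mul_ne_zero (sub_ne_zero.mpr n1) (sub_ne_zero.mpr n2)) (sub_ne_zero.mpr n3)
  refine (mul_eq_zero.mp ?_).resolve_left hprod
  simp only [smul_eq_mul]
  linear_combination
    (μ₂ - μ₃) * a₁ * (q x - μ₁) * ((q x - μ₃) * f₃ x * p2 + a₂ * G x * p3) +
    (μ₃ - μ₁) * a₂ * (q x - μ₂) * ((q x - μ₃) * f₃ x * p1 + a₁ * G x * p3) +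
    (μ₁ - μ₂) * a₃ * (q x - μ₃) * ((q x - μ₂) * f₂ x * p1 + a₁ * G x * p2)

theorem inner_tto_apply {A : K θ →L[ℂ] K θ} {φ : L2}
    (hφ : ∀ (f : K θ) (hf : MemLp (f : L2) ∞ AddCircle.haarAddCircle),
      A f = (K θ).orthogonalProjectionOnto (mulOp (f : L2) hf φ))
    {f g : K θ} (hf : MemLp (f : L2) ∞ AddCircle.haarAddCircle)
    (hg : MemLp (g : L2) ∞ AddCircle.haarAddCircle) (hfC : conjC θ f = (f : L2)) :
    ⟪f, A g⟫_ℂ = ⟪conjC θ φ, mulOp f hf g⟫_ℂ := by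
  rw [hφ g hg, Submodule.inner_orthogonalProjectionOnto_eq_of_mem_left, ← inner_conjC_mulOp θ hf hg,
    hfC]

variable {n : ℕ} {v : OrthonormalBasis (Fin n) ℂ (K θ)} {A : K θ →L[ℂ] K θ} {i j k : Fin n}

theorem IsModifiedClarkBasis.exists_linear_relation_inner (hv : IsModifiedClarkBasis θ v)
    (hA : IsTTO θ A) (hij : i ≠ j) (hik : i ≠ k) (hjk : j ≠ k) :
    ∃ c₁ c₂ c₃ : ℂ, c₁ ≠ 0 ∧ c₂ ≠ 0 ∧ c₃ ≠ 0 ∧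
      c₁ * ⟪v j, A (v k)⟫_ℂ + c₂ * ⟪v i, A (v k)⟫_ℂ + c₃ * ⟪v i, A (v j)⟫_ℂ = 0 := by
  have hfin : FiniteDimensional ℂ (K θ) := v.toBasis.finiteDimensional_of_finite
  have hbdd (l : Fin n) : MemLp (v l : L2) ∞ AddCircle.haarAddCircle :=
    K_le_boundedFunctions θ (v l).2
  obtain ⟨hC, t, α, hU⟩ := hv
  obtain ⟨φ, hφ⟩ := hA
  choose μ hμ using hU
  have hfunctional (l : Fin n) : clarkFunctional θ t (v l) ≠ 0 :=
    clarkFunctional_ne_zero (v.orthonormal.ne_zero l) (hμ l)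
  have heigenvalue {l m : Fin n} (hlm : l ≠ m) : μ l - μ m ≠ 0 :=
    sub_ne_zero.mpr ((clarkOp_eigenvalue_injective v.orthonormal.linearIndependent hμ).ne hlm)
  have hmulC (l : Fin n) : mulC (moebius t) (v l : L2) =
      μ l • (v l : L2) + clarkFunctional θ t (v l) • clarkFunction θ t α := by
    rw [← hμ l, clarkOp_apply, sub_add_cancel]
  refine ⟨_, _, _, mul_ne_zero (heigenvalue hjk) (hfunctional i),
    mul_ne_zero (heigenvalue hik.symm) (hfunctional j),
    mul_ne_zero (heigenvalue hij) (hfunctional k), ?_⟩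
  rw [inner_tto_apply hφ (hbdd j) (hbdd k) (hC j), inner_tto_apply hφ (hbdd i) (hbdd k) (hC i),
    inner_tto_apply hφ (hbdd i) (hbdd j) (hC i), ← inner_smul_right, ← inner_smul_right,
    ← inner_smul_right, ← inner_add_right, ← inner_add_right,
    linear_relation_mulOp_of_mulC_eq (hbdd i) (hbdd j) (ae_moebius_ne t) (hmulC i) (hmulC j)
      (hmulC k), inner_zero_right]

theorem IsClarkMatrixOfTTO.apply_eq_zero {M : Matrix (Fin n) (Fin n) ℂ}
    (hM : IsClarkMatrixOfTTO M) (hij : i ≠ j) (hik : i ≠ k) (hjk : j ≠ k) (hMij : M i j = 0)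
    (hMik : M i k = 0) : M j k = 0 := by
  obtain ⟨θ, A, v, hA, hv, rfl⟩ := hM
  obtain ⟨c₁, c₂, c₃, hc₁, -, -, hrel⟩ := hv.exists_linear_relation_inner hA hij hik hjk
  simp only [LinearMap.toMatrix_apply, OrthonormalBasis.coe_toBasis,
    OrthonormalBasis.coe_toBasis_repr_apply, OrthonormalBasis.repr_apply_apply,
    ContinuousLinearMap.coe_coe] at hMij hMik ⊢
  rw [hMij, hMik, mul_zero, mul_zero, add_zero, add_zero] at hrel
  exact (mul_eq_zero.mp hrel).resolve_left hc₁

end OffDiagonalEntries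

section ToeplitzMatrices

variable {n : ℕ}

/-- The inner function `zⁿ`. Its model space consists of the polynomials of degree less than `n`,
and the truncated Toeplitz operators on it are the Toeplitz matrices. -/
def powInner (n : ℕ) : InnerFunction where
  toL2 := fourierLp 2 n
  mem_H2 := fourierLp_mem_H2 n.cast_nonneg
  norm_eq_one := by
    filter_upwards [coeFn_fourierLp (T := 1) 2 n] with x hx
    rw [hx, fourier_apply, Circle.norm_coe]

theorem mem_K_powInner_iff {f : L2} :
    f ∈ K (powInner n) ↔ ∀ k : ℤ, k < 0 ∨ (n : ℤ) ≤ k → fourierCoeff f k = 0 := by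
  have hcoeff (k : ℤ) : fourierCoeff (mulConj (powInner n) f) k = fourierCoeff f (k + n) := by
    rw [← inner_fourierLp, ← inner_mulOp_toL2_left, mulOp_fourierLp, powInner,
      mulC_fourier_fourierLp, inner_fourierLp]
  simp only [mem_K_iff, mem_H2_orthogonal_iff, hcoeff]
  constructor
  · rintro ⟨hneg, hge⟩ k (hk | hk)
    · exact hneg k hk
    · simpa only [sub_add_cancel] using hge (k - n) (by lia)
  · exact fun h => ⟨fun k hk => h k (Or.inl hk), fun k hk => h _ (Or.inr (by lia))⟩

/-- The monomial `zᵐ`, `m < n`, as an element of the model space of `zⁿ`. -/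
def monomial (m : Fin n) : K (powInner n) :=
  ⟨fourierLp 2 (m : ℤ), mem_K_powInner_iff.mpr fun k hk => by
    rw [fourierCoeff_fourierLp, if_neg (by have := m.2; lia)]⟩

theorem coe_monomial (m : Fin n) : (monomial m : L2) = fourierLp 2 (m : ℤ) := rfl

theorem inner_monomial (m : Fin n) (f : K (powInner n)) :
    ⟪monomial m, f⟫_ℂ = fourierCoeff (f : L2) m :=
  inner_fourierLp m (f : L2)

theorem orthonormal_monomial : Orthonormal ℂ (monomial (n := n)) := by
  refine orthonormal_iff_ite.mpr fun i j => ?_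
  rw [inner_monomial, coe_monomial, fourierCoeff_fourierLp]
  simp only [Nat.cast_inj, Fin.ext_iff]

/-- The orthonormal basis `1, z, …, zⁿ⁻¹` of the model space of `zⁿ`. -/
def monomialBasis (n : ℕ) : OrthonormalBasis (Fin n) ℂ (K (powInner n)) :=
  OrthonormalBasis.mkOfOrthogonalEqBot orthonormal_monomial <| by
    refine (Submodule.eq_bot_iff _).mpr fun f hf =>
      Subtype.ext (eq_zero_of_fourierCoeff_eq_zero fun k => ?_)
    by_cases hk : k < 0 ∨ (n : ℤ) ≤ k
    · exact mem_K_powInner_iff.mp f.2 k hk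
    · push Not at hk
      lift k to ℕ using hk.1
      rw [← inner_monomial ⟨k, by lia⟩]
      exact (Submodule.mem_orthogonal _ _).mp hf _ (Submodule.subset_span (Set.mem_range_self _))

theorem monomialBasis_apply (m : Fin n) : monomialBasis n m = monomial m :=
  congrFun (OrthonormalBasis.coe_of_orthogonal_eq_bot_mk _ _) m

theorem isTTO_powInner_of_inner_monomial {A : K (powInner n) →L[ℂ] K (powInner n)} {c : ℤ → ℂ}
    (hA : ∀ i j : Fin n, ⟪monomial i, A (monomial j)⟫_ℂ = c (i - j)) : IsTTO (powInner n) A := by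
  let T : L2 →ₗ[ℂ] L2 := ∑ r ∈ Finset.Ioo (-n : ℤ) n, c r • mulC (fourier r)
  have hA_eq : A.toLinearMap =
      (K (powInner n)).orthogonalProjectionOnto.toLinearMap ∘ₗ T ∘ₗ (K (powInner n)).subtype := by
    refine (monomialBasis n).toBasis.ext fun j => (monomialBasis n).repr.injective ?_
    ext i
    simp only [OrthonormalBasis.coe_toBasis, OrthonormalBasis.repr_apply_apply,
      monomialBasis_apply, ContinuousLinearMap.coe_coe, hA,
      LinearMap.comp_apply, Submodule.inner_orthogonalProjectionOnto_eq_of_mem_left, T,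
      LinearMap.sum_apply, LinearMap.smul_apply, Submodule.subtype_apply, coe_monomial,
      mulC_fourier_fourierLp, inner_sum, inner_smul_right, inner_fourierLp, fourierCoeff_fourierLp]
    have hr : (i - j : ℤ) ∈ Finset.Ioo (-n : ℤ) n := by
      rw [Finset.mem_Ioo]
      have := i.2
      have := j.2
      lia
    rw [Finset.sum_eq_single_of_mem (i - j : ℤ) hr, sub_add_cancel,
      if_pos rfl, mul_one]
    intro r _ hr
    rw [if_neg (by lia), mul_zero]
  refine ⟨∑ r ∈ Finset.Ioo (-n : ℤ) n, c r • fourierLp 2 r, fun f hf => ?_⟩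
  have hT : mulOp f hf (∑ r ∈ Finset.Ioo (-n : ℤ) n, c r • fourierLp 2 r) = T f := by
    simp only [map_sum, map_smul, mulOp_fourierLp, T, LinearMap.sum_apply, LinearMap.smul_apply]
  rw [hT]
  exact LinearMap.congr_fun hA_eq f

end ToeplitzMatrices

section CirculantOperators

variable {n : ℕ}

theorem fourier_sub_apply {T : ℝ} (m : ℤ) (x y : AddCircle T) :
    fourier m (x - y) = fourier m x * conj (fourier m y) := by
  rw [← fourier_neg, fourier_apply, fourier_apply, fourier_apply, smul_sub, sub_eq_add_neg,
    ← neg_smul, AddCircle.toCircle_add, Circle.coe_mul]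

theorem sum_fourier_apply_eq_zero {T : ℝ} [hT : Fact (0 < T)] {x : AddCircle T} (hx : x ≠ 0)
    (hnx : n • x = 0) : ∑ m ∈ Finset.range n, fourier m x = 0 := by
  have hz : fourier 1 x ≠ 1 := by
    rw [← fourier_eval_zero 1, fourier_one, fourier_one]
    exact fun h => hx (AddCircle.injective_toCircle hT.out.ne' (Circle.coe_injective h))
  have hpow (m : ℕ) : fourier m x = fourier 1 x ^ m := by
    rw [fourier_apply, fourier_one, natCast_zsmul, AddCircle.toCircle_nsmul, Circle.coe_pow]
  have hzn : fourier 1 x ^ n = 1 := by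
    rw [← hpow, fourier_apply, natCast_zsmul, hnx, AddCircle.toCircle_zero, Circle.coe_one]
  simp only [hpow]
  rw [geom_sum_eq hz, hzn, sub_self, zero_div]

/-- The point `l/n` of `ℝ/ℤ`, which parametrises the `n`-th root of unity `exp (2πil/n)`. -/
def gridPoint (l : Fin n) : UnitAddCircle := (l : ℕ) • ((1 / n : ℝ) : UnitAddCircle)

theorem gridPoint_injective : Function.Injective (gridPoint (n := n)) := fun l m hlm => by
  have horder : addOrderOf ((1 / n : ℝ) : UnitAddCircle) = n :=
    AddCircle.addOrderOf_period_div l.pos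
  exact Fin.ext (nsmul_injOn_Iio_addOrderOf (by rw [Set.mem_Iio, horder]; exact l.2)
    (by rw [Set.mem_Iio, horder]; exact m.2) hlm)

theorem nsmul_gridPoint (l : Fin n) : n • gridPoint l = 0 := by
  have hzero : n • ((1 / n : ℝ) : UnitAddCircle) = 0 :=
    addOrderOf_dvd_iff_nsmul_eq_zero.mp (AddCircle.addOrderOf_period_div l.pos).dvd
  rw [gridPoint, nsmul_left_comm, hzero, nsmul_zero]

/-- The normalised boundary reproducing kernels of the model space of `zⁿ` at the `n`-th roots of
unity. -/
def gridKernel (l : Fin n) : K (powInner n) :=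
  ∑ m : Fin n, ((Real.sqrt n : ℂ)⁻¹ * conj (fourier m (gridPoint l))) • monomial m

theorem inner_monomial_gridKernel (m l : Fin n) :
    ⟪monomial m, gridKernel l⟫_ℂ = (Real.sqrt n : ℂ)⁻¹ * conj (fourier m (gridPoint l)) :=
  orthonormal_monomial.inner_right_fintype _ m

theorem inner_gridKernel_monomial (m l : Fin n) :
    ⟪gridKernel l, monomial m⟫_ℂ = (Real.sqrt n : ℂ)⁻¹ * fourier m (gridPoint l) := by
  rw [← inner_conj_symm (gridKernel l), inner_monomial_gridKernel, map_mul,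
    Complex.conj_conj, map_inv₀, conj_ofReal]

theorem inv_sqrt_mul_inv_sqrt (n : ℕ) :
    (Real.sqrt n : ℂ)⁻¹ * (Real.sqrt n : ℂ)⁻¹ = (n : ℂ)⁻¹ := by
  rw [← mul_inv, ← ofReal_mul, Real.mul_self_sqrt n.cast_nonneg, ofReal_natCast]

theorem orthonormal_gridKernel : Orthonormal ℂ (gridKernel (n := n)) := by
  refine orthonormal_iff_ite.mpr fun k l => ?_
  have hinner : ⟪gridKernel k, gridKernel l⟫_ℂ =
      (n : ℂ)⁻¹ * ∑ m ∈ Finset.range n, fourier m (gridPoint k - gridPoint l) := by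
    rw [← (monomialBasis n).sum_inner_mul_inner, ← Fin.sum_univ_eq_sum_range
      (fun m => fourier (m : ℤ) (gridPoint k - gridPoint l)), Finset.mul_sum]
    refine Finset.sum_congr rfl fun m _ => ?_
    rw [monomialBasis_apply, inner_gridKernel_monomial, inner_monomial_gridKernel,
      fourier_sub_apply, ← inv_sqrt_mul_inv_sqrt]
    ring
  rw [hinner]
  split_ifs with hkl
  · have hn : (n : ℂ) ≠ 0 := Nat.cast_ne_zero.mpr k.pos.ne'
    simp only [hkl, sub_self, fourier_eval_zero, Finset.sum_const, Finset.card_range,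
      nsmul_eq_mul, mul_one, inv_mul_cancel₀ hn]
  · rw [sum_fourier_apply_eq_zero (sub_ne_zero.mpr (gridPoint_injective.ne hkl)), mul_zero]
    rw [smul_sub, nsmul_gridPoint, nsmul_gridPoint, sub_zero]

instance : FiniteDimensional ℂ (K (powInner n)) :=
  (monomialBasis n).toBasis.finiteDimensional_of_finite

/-- The orthonormal basis of the model space of `zⁿ` consisting of the normalised boundary kernels
at the `n`-th roots of unity. -/
def gridKernelBasis (n : ℕ) : OrthonormalBasis (Fin n) ℂ (K (powInner n)) :=
  OrthonormalBasis.mk orthonormal_gridKernel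
    (orthonormal_gridKernel.linearIndependent.span_eq_top_of_card_eq_finrank'
      (Module.finrank_eq_card_basis (monomialBasis n).toBasis).symm).ge

theorem gridKernelBasis_apply (l : Fin n) : gridKernelBasis n l = gridKernel l :=
  congrFun (OrthonormalBasis.coe_mk _ _) l

theorem isTTO_of_apply_gridKernel_eq_smul {A : K (powInner n) →L[ℂ] K (powInner n)} {μ : Fin n → ℂ}
    (hA : ∀ l, A (gridKernel l) = μ l • gridKernel l) : IsTTO (powInner n) A := by
  refine isTTO_powInner_of_inner_monomial
    (c := fun r => (n : ℂ)⁻¹ * ∑ l, μ l * conj (fourier r (gridPoint l))) fun i j => ?_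
  rw [← (gridKernelBasis n).sum_repr' (monomial j), map_sum, inner_sum, Finset.mul_sum]
  refine Finset.sum_congr rfl fun l _ => ?_
  rw [gridKernelBasis_apply, map_smul, hA, inner_smul_right (monomial i),
    inner_smul_right (monomial i), inner_gridKernel_monomial, inner_monomial_gridKernel,
    sub_eq_add_neg, fourier_add, fourier_neg, map_mul, Complex.conj_conj, ← inv_sqrt_mul_inv_sqrt]
  ring

theorem unitarilyEquivToTTO_of_orthonormalBasis {M : Matrix (Fin n) (Fin n) ℂ}
    (b : OrthonormalBasis (Fin n) ℂ (EuclideanSpace ℂ (Fin n))) {μ : Fin n → ℂ}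
    (hM : ∀ l, M.toEuclideanLin (b l) = μ l • b l) : UnitarilyEquivToTTO M := by
  let U := b.equiv (gridKernelBasis n) (Equiv.refl _)
  let A := U.toContinuousLinearEquiv.toContinuousLinearMap ∘L
    M.toEuclideanLin.toContinuousLinearMap ∘L U.symm.toContinuousLinearEquiv.toContinuousLinearMap
  have hAU (x : EuclideanSpace ℂ (Fin n)) : A (U x) = U (M.toEuclideanLin x) :=
    congrArg (fun y => U (M.toEuclideanLin y)) (U.symm_apply_apply x)
  have hU (l : Fin n) : U (b l) = gridKernel l := by
    rw [OrthonormalBasis.equiv_apply_basis, Equiv.refl_apply, gridKernelBasis_apply]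
  refine ⟨powInner n, A, isTTO_of_apply_gridKernel_eq_smul (μ := μ) fun l => ?_, U,
    fun x => (hAU x).symm⟩
  rw [← hU, hAU, hM, map_smul]

theorem unitarilyEquivToTTO_of_isHermitian {M : Matrix (Fin n) (Fin n) ℂ} (hM : M.IsHermitian) :
    UnitarilyEquivToTTO M :=
  unitarilyEquivToTTO_of_orthonormalBasis hM.eigenvectorBasis (μ := fun l => hM.eigenvalues l)
    fun l => WithLp.ofLp_injective 2 (hM.mulVec_eigenvectorBasis l)

end CirculantOperators

end ModelSpace

end

theorem mainTheorem3_general {n : ℕ} {S : Matrix (Fin n) (Fin n) ℂ} (hS : S.IsHermitian)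
    {i j k : Fin n} (hij : i ≠ j) (hik : i ≠ k) (hjk : j ≠ k) (hSij : S i j = 0) (hSik : S i k = 0)
    (hSjk : S j k ≠ 0) : ModelSpace.UnitarilyEquivToTTO S ∧ ¬ ModelSpace.IsClarkMatrixOfTTO S :=
  ⟨ModelSpace.unitarilyEquivToTTO_of_isHermitian hS,
    fun hM => hSjk (hM.apply_eq_zero hij hik hjk hSij hSik)⟩

theorem mainTheorem3 :
    (∀ (a b c : ℝ) (S : Matrix (Fin 3) (Fin 3) ℂ),
      (S = !![(a : ℂ), 0, 1; 0, (b : ℂ), 0; 1, 0, (c : ℂ)] ∨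
       S = !![(a : ℂ), 1, 0; 1, (b : ℂ), 0; 0, 0, (c : ℂ)] ∨
       S = !![(a : ℂ), 0, 0; 0, (b : ℂ), 1; 0, 1, (c : ℂ)]) →
        ModelSpace.UnitarilyEquivToTTO S ∧ ¬ ModelSpace.IsClarkMatrixOfTTO S) ∧
    ¬ (∀ (n : ℕ) (M : Matrix (Fin n) (Fin n) ℂ), M.IsSymm →
        ModelSpace.UnitarilyEquivToTTO M → ModelSpace.IsClarkMatrixOfTTO M) := by
  refine (and_iff_left_of_imp fun hmatrices h => ?_).mpr fun a b c S hS => ?_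
  · obtain ⟨hequiv, hnot⟩ := hmatrices 0 0 0 _ (Or.inl rfl)
    refine hnot (h 3 _ ?_ hequiv)
    ext i j
    fin_cases i <;> fin_cases j <;> rfl
  · have hHermitian : S.IsHermitian := by
      rcases hS with rfl | rfl | rfl <;>
      · ext i j
        fin_cases i <;> fin_cases j <;> simp [Matrix.conjTranspose_apply]
    rcases hS with rfl | rfl | rfl
    · exact mainTheorem3_general hHermitian (i := 1) (j := 0) (k := 2) (by decide) (by decide)
        (by decide) rfl rfl one_ne_zero
    · exact mainTheorem3_general hHermitian (i := 2) (j := 0) (k := 1) (by decide) (by decide)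
        (by decide) rfl rfl one_ne_zero
    · exact mainTheorem3_general hHermitian (i := 0) (j := 1) (k := 2) (by decide) (by decide)
        (by decide) rfl rfl one_ne_zero
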